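/- **Setting.** Let $X,Y$ be real or complex Hilbert spaces, $X_0\subseteq X_1\subseteq\dots$ closed subspaces of $X$, and $P_N$ the orthogonal projector onto $X_N$. Let $T_N:X_N\to Y$ be linear with $\|T_N\|\le 1$ and $T_Nx=T_Mx$ for all $x\in X_M$, $M\le N$. Let $T_N^*:Y\to X_N$ be the adjoint. Let $x_*\in X_{N_*}$ and $T_{N_*}x_*=y$, and suppose $T_{N_*}$ is continuously invertible, i.e. has a bounded linear inverse on its range. Fix $\eta>0$ and $\tau>1$. **CGNE at level $N$** with data $y^\delta$ and initial guess $x_{0,N}\in X_N$: $r_0=w_0=y^\delta-T_Nx_{0,N}$ and, for $k\ge 0$, $d_k=T_N^*w_k$, $\alpha_k=\|T_N^*r_k\|^2/\|T_Nd_k\|^2$, $x_{k+1,N}=x_{k,N}+\alpha_kd_k$, $r_{k+1}=r_k-\alpha_kT_Nd_k$, $\beta_k=\|T_N^*r_{k+1}\|^2/\|T_N^*r_k\|^2$, $w_{k+1}=r_{k+1}+\beta_kw_k$. **Stopping rules.** Let $\theta_N=2(1+\eta)(\delta+\|P_Nx_*-x_*\|)\|y^\delta\|$ and $\theta=2(1+\eta)\tau\delta\|y^\delta\|$.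 The generalized discrepancy principle at level $N$ determines $k_*(N,\delta)$ as the index $k$ with $\|T_Nx_{j,N}-y^\delta\|^2>\theta_N$ for $0\le j\le k$ and $\|T_Nx_{k+1,N}-y^\delta\|^2\le\theta_N$. The terminal criterion is $\|T_Nx_{k,N}-y^\delta\|^2\le\theta$. **Multi-level algorithm.** Let an initial guess $x_{0,0}\in X_0$ be given. If $\theta<\|T_0x_{0,0}-y^\delta\|^2\le\theta_0$, begin at a level $J\le N_*$ with $\|T_0x_{0,0}-y^\delta\|^2>\theta_J$; otherwise begin at level $J=0$. In both cases $x_{0,J}=x_{0,0}$. At each level $N$ run CGNE, computing $x_{0,N},x_{1,N},\dots,x_{k_*(N,\delta)+1,N}$. As soon as one of these iterates meets the terminal criterion, the whole algorithm terminates with that iterate, denoted $x^\delta_{N(\delta),K_*}$. If none does, pass to level $N+1$ with $x_{0,N+1}=x_{k_*(N,\delta),N}$. **Theorem 2.7.** (a) For every $\delta>0$, every $y^\delta\ne 0$ with $\|y^\delta-y\|\le\delta$ and every $x_{0,0}\in X_0$, a starting level $J\le N_*$ as above exists. For every such $J$ the algorithm terminates after finitely many iterations, and $N(\delta)$, $K_*$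 and the final iterate are uniquely determined. (b) The final iterate converges to $x_*$ as $\delta\to0$: for every $\varepsilon>0$ there is $\delta_0>0$ such that, for all $0<\delta<\delta_0$, all $y^\delta$ with $\|y^\delta-y\|\le\delta$, all $x_{0,0}\in X_0$ and all admissible $J\le N_*$, whenever the algorithm terminates, $$\|x^\delta_{N(\delta),K_*}-x_*\|<\varepsilon .$$ -/

import Mathlib

noncomputable section

namespace MultiLevelCG

/-- A bounded operator is continuously invertible if it has a bounded linear inverse, defined on
its range.  The range need not be all of `Y`. -/
def ContinuouslyInvertible {𝕜 U Y : Type*} [RCLike 𝕜]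
    [NormedAddCommGroup U] [InnerProductSpace 𝕜 U]
    [NormedAddCommGroup Y] [InnerProductSpace 𝕜 Y] (T : U →L[𝕜] Y) : Prop :=
  ∃ S : LinearMap.range (T : U →ₗ[𝕜] Y) →L[𝕜] U,
    ∀ x : U, S ⟨T x, LinearMap.mem_range_self (T : U →ₗ[𝕜] Y) x⟩ = x

section CGNE

variable {𝕜 U Y : Type*} [RCLike 𝕜]
  [NormedAddCommGroup U] [InnerProductSpace 𝕜 U] [CompleteSpace U]
  [NormedAddCommGroup Y] [InnerProductSpace 𝕜 Y] [CompleteSpace Y]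

/-- The variables `x_k`, `r_k`, `w_k` of the CGNE method. -/
structure CGState (U Y : Type*) where
  x : U
  r : Y
  w : Y

/-- Initialization with initial guess `x₀`: `r₀ = w₀ = y - T x₀`. -/
def cgInit (T : U →L[𝕜] Y) (y : Y) (x₀ : U) : CGState U Y where
  x := x₀
  r := y - T x₀
  w := y - T x₀

/-- The search direction `d_k = T^* w_k`. -/
def cgDir (T : U →L[𝕜] Y) (s : CGState U Y) : U :=
  ContinuousLinearMap.adjoint T s.w

/-- The step length `α_k = ‖T^* r_k‖² / ‖T d_k‖²`. -/
def cgAlpha (T : U →L[𝕜] Y) (s : CGState U Y) : ℝ :=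
  ‖ContinuousLinearMap.adjoint T s.r‖ ^ 2 / ‖T (cgDir T s)‖ ^ 2

/-- The updated residual `r_{k+1} = r_k - α_k T d_k`. -/
def cgRes (T : U →L[𝕜] Y) (s : CGState U Y) : Y :=
  s.r - (cgAlpha T s : 𝕜) • T (cgDir T s)

/-- The coefficient `β_k = ‖T^* r_{k+1}‖² / ‖T^* r_k‖²`. -/
def cgBeta (T : U →L[𝕜] Y) (s : CGState U Y) : ℝ :=
  ‖ContinuousLinearMap.adjoint T (cgRes T s)‖ ^ 2 / ‖ContinuousLinearMap.adjoint T s.r‖ ^ 2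

/-- One step of the CGNE method. -/
def cgStep (T : U →L[𝕜] Y) (s : CGState U Y) : CGState U Y where
  x := s.x + (cgAlpha T s : 𝕜) • cgDir T s
  r := cgRes T s
  w := cgRes T s + (cgBeta T s : 𝕜) • s.w

/-- The `k`-th iterate `x_k` of CGNE for `T x = y` with initial guess `x₀`. -/
def cgIter (T : U →L[𝕜] Y) (y : Y) (x₀ : U) (k : ℕ) : U :=
  ((cgStep T)^[k] (cgInit T y x₀)).x

end CGNE

/-- Nested closed subspaces `X_N` of `X` with operators `T_N : X_N → Y` of norm at most one
such that `T_N` extends `T_M` for `M ≤ N`.  The adjoint of `T_N` maps into `X_N` by its type. -/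
structure LevelSystem (𝕜 X Y : Type*) [RCLike 𝕜]
    [NormedAddCommGroup X] [InnerProductSpace 𝕜 X]
    [NormedAddCommGroup Y] [InnerProductSpace 𝕜 Y] where
  space : ℕ → Submodule 𝕜 X
  isClosed : ∀ N, IsClosed (space N : Set X)
  mono : Monotone space
  op : ∀ N, space N →L[𝕜] Y
  norm_op_le : ∀ N, ‖op N‖ ≤ 1
  op_eq : ∀ {M N : ℕ} (h : M ≤ N) (x : space M),
    op N (Submodule.inclusion (mono h) x) = op M x

variable {𝕜 X Y : Type*} [RCLike 𝕜]
  [NormedAddCommGroup X] [InnerProductSpace 𝕜 X] [CompleteSpace X]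
  [NormedAddCommGroup Y] [InnerProductSpace 𝕜 Y] [CompleteSpace Y]

instance (S : LevelSystem 𝕜 X Y) (N : ℕ) : CompleteSpace (S.space N) :=
  (S.isClosed N).completeSpace_coe

/-- The squared discrepancy `‖T_N x - y^δ‖²`. -/
def sqRes (S : LevelSystem 𝕜 X Y) (yd : Y) (N : ℕ) (x : S.space N) : ℝ :=
  ‖S.op N x - yd‖ ^ 2

/-- The tolerance `2(1+η)(δ + ‖P_N x_* - x_*‖)‖y^δ‖` of the generalized discrepancy principle
at level `N`. -/
def levelTol (S : LevelSystem 𝕜 X Y) (η : ℝ) (xs : X) (δ : ℝ) (yd : Y) (N : ℕ) : ℝ :=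
  2 * (1 + η) * (δ + ‖(S.space N).starProjection xs - xs‖) * ‖yd‖

/-- The tolerance `2(1+η)τδ‖y^δ‖` that terminates the whole algorithm. -/
def finalTol (η τ δ : ℝ) (yd : Y) : ℝ :=
  2 * (1 + η) * τ * δ * ‖yd‖

/-- `J` is an admissible level at which to begin with the initial guess `x00 ∈ X_0`.
If `x00` violates the terminal criterion, but already satisfies the discrepancy principle of
level `0`, then `J` is a level whose discrepancy principle `x00` does not satisfy; in all other
cases `J = 0`. -/
def IsStartLevel (S : LevelSystem 𝕜 X Y) (η τ : ℝ) (xs : X) (δ : ℝ) (yd : Y)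
    (x00 : S.space 0) (J : ℕ) : Prop :=
  if finalTol η τ δ yd < sqRes S yd 0 x00 ∧ sqRes S yd 0 x00 ≤ levelTol S η xs δ yd 0 then
    levelTol S η xs δ yd J < sqRes S yd 0 x00
  else J = 0

/-- `k = k_*(N,δ)` for the CGNE iteration at level `N` with initial guess `z`: the discrepancy
exceeds the tolerance of the level up to index `k`, and no longer at index `k + 1`. -/
def IsLevelStop (S : LevelSystem 𝕜 X Y) (η : ℝ) (xs : X) (δ : ℝ) (yd : Y)
    (N : ℕ) (z : S.space N) (k : ℕ) : Prop :=
  (∀ j ≤ k, levelTol S η xs δ yd N < sqRes S yd N (cgIter (S.op N) yd z j)) ∧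
    sqRes S yd N (cgIter (S.op N) yd z (k + 1)) ≤ levelTol S η xs δ yd N

/-- `Entered … N z`: the multi-level algorithm begun at level `J` with `x00` reaches level `N`,
with initial guess `x_{0,N} = z` there.  It passes from level `N` to level `N + 1` when the level
stops with index `k = k_*(N,δ)` and none of the iterates `x_{0,N}, …, x_{k+1,N}` meets the
terminal criterion; then `x_{0,N+1} = x_{k,N}`. -/
inductive Entered (S : LevelSystem 𝕜 X Y) (η τ : ℝ) (xs : X) (δ : ℝ) (yd : Y)
    (x00 : S.space 0) (J : ℕ) : (N : ℕ) → S.space N → Prop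
  | start : Entered S η τ xs δ yd x00 J J (Submodule.inclusion (S.mono (Nat.zero_le J)) x00)
  | next {N : ℕ} {z : S.space N} {k : ℕ}
      (hz : Entered S η τ xs δ yd x00 J N z)
      (hk : IsLevelStop S η xs δ yd N z k)
      (hf : ∀ j ≤ k + 1, finalTol η τ δ yd < sqRes S yd N (cgIter (S.op N) yd z j)) :
      Entered S η τ xs δ yd x00 J (N + 1)
        (Submodule.inclusion (S.mono (Nat.le_succ N)) (cgIter (S.op N) yd z k))

/-- The multi-level algorithm terminates at level `N` with index `K` and final iterate
`x = x_{K,N}`: the terminal criterion holds there for the first time, and level `N` has not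
been left before index `K` by its discrepancy principle (that is, `K ≤ k_*(N,δ) + 1`). -/
def IsOutput (S : LevelSystem 𝕜 X Y) (η τ : ℝ) (xs : X) (δ : ℝ) (yd : Y)
    (x00 : S.space 0) (J N K : ℕ) (x : X) : Prop :=
  ∃ z : S.space N, Entered S η τ xs δ yd x00 J N z ∧
    (∀ k < K, levelTol S η xs δ yd N < sqRes S yd N (cgIter (S.op N) yd z k) ∧
      finalTol η τ δ yd < sqRes S yd N (cgIter (S.op N) yd z k)) ∧
    sqRes S yd N (cgIter (S.op N) yd z K) ≤ finalTol η τ δ yd ∧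
    x = ((cgIter (S.op N) yd z K : S.space N) : X)

end MultiLevelCG

end

/-! On one level, two local orthogonality relations (`CGInvariant`) survive every CGNE step and,
with `‖T‖ ≤ 1`, give `‖r_{k+1}‖² + ‖T^* r_k‖² ≤ ‖r_k‖²`. So the gradients tend to zero. If `T` is
bounded below, the iterates stay bounded, and the limit of the residual norms is at most `‖y - T v‖`
for every `v` (`exists_norm_sq_cgIter_le`). No Krylov space optimality is needed.

Each `T_N` with `N ≤ N_*` is a restriction of `T_{N_*}`, hence bounded below. Comparing with `v =
P_N x_*` and `v = 0` shows that its discrepancy principle is reached. The tolerances decrease with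
the level, so a guess handed upward violates the next one. At `N_*` the projection error vanishes
and `τ > 1` puts the level tolerance below the terminal one, so that level is never left.
Termination follows, and uniqueness holds because every transition is deterministic.

The output has a residual controlled by `δ`; the bounded inverse of `T_{N_*}` turns this into an
error bound that vanishes with `δ`. -/

noncomputable section

namespace MultiLevelCG

open ContinuousLinearMap Filter Topology

/-! ### CGNE on a single level: local orthogonality -/

section CGNE

variable {𝕜 U Y : Type*} [RCLike 𝕜]
  [NormedAddCommGroup U] [InnerProductSpace 𝕜 U] [CompleteSpace U]
  [NormedAddCommGroup Y] [InnerProductSpace 𝕜 Y] [CompleteSpace Y]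

/-- The local orthogonality relations of CGNE, together with the meaning of the residual. -/
structure CGInvariant (T : U →L[𝕜] Y) (y : Y) (s : CGState U Y) : Prop where
  res_eq : s.r = y - T s.x
  grad_orth : inner 𝕜 (adjoint T s.r) (cgDir T s - adjoint T s.r) = 0
  dir_conj : inner 𝕜 (T (cgDir T s - adjoint T s.r)) (T (cgDir T s)) = 0

variable {T : U →L[𝕜] Y} {y : Y} {s : CGState U Y}

lemma cgInvariant_zero (T : U →L[𝕜] Y) (y : Y) (x₀ : U) : CGInvariant T y (cgInit T y x₀) := by
  constructor <;> simp [cgInit, cgDir]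

/-- `d = T^* w` gives `⟪d, d⟫ = ⟪w, T d⟫`. This handles breakdown, where `α` is a division by zero:
the gradient then vanishes too. -/
lemma cgDir_eq_zero_of_map_eq_zero (h : T (cgDir T s) = 0) : cgDir T s = 0 := by
  have h1 : inner 𝕜 (cgDir T s) (cgDir T s) = 0 := by
    conv_lhs => rw [cgDir]
    rw [adjoint_inner_left]
    change inner 𝕜 s.w (T (cgDir T s)) = 0
    rw [h, inner_zero_right]
  exact inner_self_eq_zero.mp h1

namespace CGInvariant

lemma inner_grad_dir (h : CGInvariant T y s) :
    inner 𝕜 (adjoint T s.r) (cgDir T s) = (‖adjoint T s.r‖ : 𝕜) ^ 2 := by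
  have := h.grad_orth
  rwa [inner_sub_right, sub_eq_zero, inner_self_eq_norm_sq_to_K] at this

lemma grad_eq_zero (h : CGInvariant T y s) (h0 : T (cgDir T s) = 0) : adjoint T s.r = 0 := by
  have := h.inner_grad_dir
  rw [cgDir_eq_zero_of_map_eq_zero h0, inner_zero_right] at this
  simpa using this.symm

lemma alpha_mul (h : CGInvariant T y s) :
    cgAlpha T s * ‖T (cgDir T s)‖ ^ 2 = ‖adjoint T s.r‖ ^ 2 := by
  by_cases h0 : T (cgDir T s) = 0
  · simp [h.grad_eq_zero h0, h0]
  · have : ‖T (cgDir T s)‖ ≠ 0 := norm_ne_zero_iff.mpr h0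
    rw [cgAlpha]
    field_simp

lemma inner_res_map_dir (h : CGInvariant T y s) :
    inner 𝕜 (cgRes T s) (T (cgDir T s)) = 0 := by
  rw [cgRes, inner_sub_left, inner_smul_left, ← adjoint_inner_left, h.inner_grad_dir,
    inner_self_eq_norm_sq_to_K, RCLike.conj_ofReal]
  have := congrArg (RCLike.ofReal (K := 𝕜)) h.alpha_mul
  push_cast at this
  rw [this, sub_self]

lemma adjoint_res (T : U →L[𝕜] Y) (s : CGState U Y) : adjoint T (cgRes T s) =
    adjoint T s.r - (cgAlpha T s : 𝕜) • adjoint T (T (cgDir T s)) := by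
  simp [cgRes]

lemma inner_grad_succ_dir (h : CGInvariant T y s) :
    inner 𝕜 (adjoint T (cgRes T s)) (cgDir T s) = 0 := by
  rw [adjoint_inner_left, h.inner_res_map_dir]

/-- The new gradient is orthogonal to `d`, and also to `d - T^* r` by the two invariants. -/
lemma inner_grad_succ_grad (h : CGInvariant T y s) :
    inner 𝕜 (adjoint T (cgRes T s)) (adjoint T s.r) = 0 := by
  have h1 : inner 𝕜 (adjoint T (cgRes T s)) (cgDir T s - adjoint T s.r) = 0 := by
    rw [adjoint_res, inner_sub_left, h.grad_orth, inner_smul_left, adjoint_inner_left,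
      inner_eq_zero_symm.mp h.dir_conj, mul_zero, sub_zero]
  rwa [inner_sub_right, h.inner_grad_succ_dir, zero_sub, neg_eq_zero] at h1

lemma cgDir_step (T : U →L[𝕜] Y) (s : CGState U Y) : cgDir T (cgStep T s) =
    adjoint T (cgRes T s) + (cgBeta T s : 𝕜) • cgDir T s := by
  simp [cgDir, cgStep]

/-- With `g, g'` the old and new gradients, `α T^* T d = g - g'` and `g ⊥ g'` give `α ⟪T d, T g'⟫ =
-‖g'‖²`, while `α β ‖T d‖² = ‖g'‖²`. The product form is the conjugacy of the next step, since `d' -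
g' = β d`. -/
lemma beta_conj (h : CGInvariant T y s) :
    (cgBeta T s : 𝕜) * (inner 𝕜 (T (cgDir T s)) (T (adjoint T (cgRes T s))) +
      (cgBeta T s : 𝕜) * (‖T (cgDir T s)‖ : 𝕜) ^ 2) = 0 := by
  by_cases hg : adjoint T s.r = 0
  · simp [cgBeta, hg]
  have hg' : ‖adjoint T s.r‖ ≠ 0 := norm_ne_zero_iff.mpr hg
  have hd : ‖T (cgDir T s)‖ ≠ 0 := norm_ne_zero_iff.mpr fun h0 => hg (h.grad_eq_zero h0)
  have hα : cgAlpha T s ≠ 0 := by rw [cgAlpha]; positivity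
  have h1 : (cgAlpha T s : 𝕜) * inner 𝕜 (T (cgDir T s)) (T (adjoint T (cgRes T s))) =
      -(‖adjoint T (cgRes T s)‖ : 𝕜) ^ 2 := by
    have h2 : inner 𝕜 (adjoint T (cgRes T s)) (adjoint T (cgRes T s)) =
        inner 𝕜 (adjoint T s.r - (cgAlpha T s : 𝕜) • adjoint T (T (cgDir T s)))
          (adjoint T (cgRes T s)) := by
      rw [← adjoint_res]
    rw [inner_self_eq_norm_sq_to_K, inner_sub_left,
      inner_eq_zero_symm.mp h.inner_grad_succ_grad, zero_sub, inner_smul_left,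
      RCLike.conj_ofReal, adjoint_inner_left] at h2
    rw [h2, neg_neg]
  have h3 : cgAlpha T s * (cgBeta T s * ‖T (cgDir T s)‖ ^ 2) = ‖adjoint T (cgRes T s)‖ ^ 2 := by
    rw [cgAlpha, cgBeta]
    field_simp
  have h4 := congrArg (RCLike.ofReal (K := 𝕜)) h3
  push_cast at h4
  have hα' : (cgAlpha T s : 𝕜) ≠ 0 := by exact_mod_cast hα
  refine mul_eq_zero_of_right _ (mul_left_cancel₀ hα' ?_)
  rw [mul_add, h1, h4, mul_zero, neg_add_cancel]

lemma step (h : CGInvariant T y s) : CGInvariant T y (cgStep T s) where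
  res_eq := by
    simp [cgStep, cgRes, h.res_eq, sub_sub]
  grad_orth := by
    rw [cgDir_step]
    simp [cgStep, inner_smul_right, h.inner_grad_succ_dir]
  dir_conj := by
    rw [cgDir_step]
    change inner 𝕜 (T (_ + _ - adjoint T (cgRes T s))) _ = 0
    rw [add_sub_cancel_left, map_smul, map_add, map_smul, inner_smul_left, inner_add_right,
      inner_smul_right, inner_self_eq_norm_sq_to_K, RCLike.conj_ofReal, h.beta_conj]

/-- Conjugacy gives `‖T d‖² = ⟪T T^* r, T d⟫`; apply Cauchy–Schwarz. Hence `α ≥ 1` unless `T d = 0`.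
-/
lemma norm_map_dir_le (h : CGInvariant T y s) (hT : ‖T‖ ≤ 1) :
    ‖T (cgDir T s)‖ ≤ ‖adjoint T s.r‖ := by
  have h1 : inner 𝕜 (T (cgDir T s)) (T (cgDir T s)) =
      inner 𝕜 (T (adjoint T s.r)) (T (cgDir T s)) := by
    have := h.dir_conj
    rwa [map_sub, inner_sub_left, sub_eq_zero] at this
  have h2 : ‖T (cgDir T s)‖ * ‖T (cgDir T s)‖ ≤ ‖T (adjoint T s.r)‖ * ‖T (cgDir T s)‖ := by
    have h3 := norm_inner_le_norm (𝕜 := 𝕜) (T (adjoint T s.r)) (T (cgDir T s))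
    rw [← h1, inner_self_eq_norm_sq_to_K] at h3
    simpa [pow_two] using h3
  have h4 : ‖T (adjoint T s.r)‖ ≤ ‖adjoint T s.r‖ := by
    simpa using T.le_of_opNorm_le hT (adjoint T s.r)
  nlinarith [norm_nonneg (T (cgDir T s)), norm_nonneg (adjoint T s.r)]

/-- Pythagoras for `r = r' + α T d`, where `α² ‖T d‖² = α ‖T^* r‖² ≥ ‖T^* r‖²`. -/
lemma norm_sq_res_succ (h : CGInvariant T y s) (hT : ‖T‖ ≤ 1) :
    ‖(cgStep T s).r‖ ^ 2 + ‖adjoint T s.r‖ ^ 2 ≤ ‖s.r‖ ^ 2 := by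
  have h1 : s.r = cgRes T s + (cgAlpha T s : 𝕜) • T (cgDir T s) := by simp [cgRes]
  have h2 : ‖s.r‖ * ‖s.r‖ = ‖cgRes T s‖ * ‖cgRes T s‖ +
      ‖(cgAlpha T s : 𝕜) • T (cgDir T s)‖ * ‖(cgAlpha T s : 𝕜) • T (cgDir T s)‖ := by
    conv_lhs => rw [h1]
    apply norm_add_sq_eq_norm_sq_add_norm_sq_of_inner_eq_zero (𝕜 := 𝕜)
    rw [inner_smul_right, h.inner_res_map_dir, mul_zero]
  have hα : 0 ≤ cgAlpha T s := by rw [cgAlpha]; positivity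
  rw [norm_smul, RCLike.norm_ofReal, abs_of_nonneg hα] at h2
  have h3 := h.norm_map_dir_le hT
  have h4 := h.alpha_mul
  change ‖cgRes T s‖ ^ 2 + _ ≤ _
  have h5 : ‖adjoint T s.r‖ ^ 2 ≤ cgAlpha T s * ‖adjoint T s.r‖ ^ 2 := by
    rcases eq_or_ne (‖T (cgDir T s)‖) 0 with h0 | h0
    · simp [h.grad_eq_zero (norm_eq_zero.mp h0)]
    · have : 1 ≤ cgAlpha T s := by
        rw [cgAlpha, one_le_div (by positivity)]
        gcongr
      nlinarith [sq_nonneg ‖adjoint T s.r‖]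
  have h6 : cgAlpha T s * ‖adjoint T s.r‖ ^ 2 =
      cgAlpha T s * ‖T (cgDir T s)‖ * (cgAlpha T s * ‖T (cgDir T s)‖) := by
    rw [← h4]; ring
  nlinarith

end CGInvariant

/-! ### Decay of residuals and gradients -/

lemma cgInvariant_iterate (T : U →L[𝕜] Y) (y : Y) (x₀ : U) (k : ℕ) :
    CGInvariant T y ((cgStep T)^[k] (cgInit T y x₀)) := by
  induction k with
  | zero => exact cgInvariant_zero T y x₀
  | succ k ih =>
    rw [Function.iterate_succ_apply']
    exact ih.step

lemma norm_sq_cgIter_succ (hT : ‖T‖ ≤ 1) (y : Y) (x₀ : U) (k : ℕ) :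
    ‖y - T (cgIter T y x₀ (k + 1))‖ ^ 2 + ‖adjoint T (y - T (cgIter T y x₀ k))‖ ^ 2 ≤
      ‖y - T (cgIter T y x₀ k)‖ ^ 2 := by
  have h := (cgInvariant_iterate T y x₀ k).norm_sq_res_succ hT
  rw [← Function.iterate_succ_apply' (cgStep T), (cgInvariant_iterate T y x₀ (k + 1)).res_eq,
    (cgInvariant_iterate T y x₀ k).res_eq] at h
  exact h

lemma antitone_norm_res_cgIter (hT : ‖T‖ ≤ 1) (y : Y) (x₀ : U) :
    Antitone fun k => ‖y - T (cgIter T y x₀ k)‖ := by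
  refine antitone_nat_of_succ_le fun k => le_of_sq_le_sq ?_ (norm_nonneg _)
  linarith [norm_sq_cgIter_succ hT y x₀ k, sq_nonneg ‖adjoint T (y - T (cgIter T y x₀ k))‖]

lemma norm_res_cgIter_le (hT : ‖T‖ ≤ 1) (y : Y) (x₀ : U) (k : ℕ) :
    ‖y - T (cgIter T y x₀ k)‖ ≤ ‖y - T x₀‖ :=
  antitone_norm_res_cgIter hT y x₀ (Nat.zero_le k)

/-- The gradients `T^*(y - T x_k)` of CGNE converge to zero. -/
lemma tendsto_norm_grad_cgIter (hT : ‖T‖ ≤ 1) (y : Y) (x₀ : U) :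
    Tendsto (fun k => ‖adjoint T (y - T (cgIter T y x₀ k))‖) atTop (𝓝 0) := by
  have hs : Summable fun k => ‖adjoint T (y - T (cgIter T y x₀ k))‖ ^ 2 := by
    refine summable_of_sum_range_le (c := ‖y - T x₀‖ ^ 2) (fun _ => sq_nonneg _) fun n => ?_
    have : ∑ k ∈ Finset.range n, ‖adjoint T (y - T (cgIter T y x₀ k))‖ ^ 2 ≤
        ‖y - T x₀‖ ^ 2 - ‖y - T (cgIter T y x₀ n)‖ ^ 2 := by
      induction n with
      | zero => simp [cgIter, cgInit]
      | succ n ih =>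
        rw [Finset.sum_range_succ]
        linarith [norm_sq_cgIter_succ hT y x₀ n]
    linarith [sq_nonneg ‖y - T (cgIter T y x₀ n)‖]
  have h := hs.tendsto_atTop_zero.sqrt
  simpa using h

/-- If `T` is bounded below, then the residuals of CGNE come as close to minimal as desired. -/
lemma exists_norm_sq_cgIter_le (hT : ‖T‖ ≤ 1) {C : ℝ} (hC : ∀ x, ‖x‖ ≤ C * ‖T x‖) (y : Y)
    (x₀ : U) {e t : ℝ} {u : U} (hu : ‖y - T u‖ ≤ e) (ht : e * ‖y‖ < t) :
    ∃ k, ‖T (cgIter T y x₀ k) - y‖ ^ 2 ≤ t := by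
  by_contra! hcon
  simp_rw [norm_sub_rev _ y] at hcon
  have he : 0 ≤ e := (norm_nonneg _).trans hu
  have hC0 : 0 ≤ |C| := abs_nonneg C
  set R := ‖y - T x₀‖
  have hbd : ∀ v k, ‖v - cgIter T y x₀ k‖ ≤ |C| * (‖y - T v‖ + R) := fun v k => by
    refine (hC _).trans ?_
    refine mul_le_mul (le_abs_self C) ?_ (norm_nonneg _) hC0
    have h1 : T (v - cgIter T y x₀ k) = (y - T (cgIter T y x₀ k)) - (y - T v) := by
      rw [map_sub]; abel
    rw [h1]
    linarith [norm_sub_le (y - T (cgIter T y x₀ k)) (y - T v), norm_res_cgIter_le hT y x₀ k]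
  -- Split `r = (y - T v) + T (v - x_k)` in `⟪r, r⟫`; the second part meets only the gradient, which
  -- tends to zero.
  have hkey : ∀ v k, ‖y - T (cgIter T y x₀ k)‖ ^ 2 ≤ ‖y - T (cgIter T y x₀ k)‖ * ‖y - T v‖ +
      ‖adjoint T (y - T (cgIter T y x₀ k))‖ * (|C| * (‖y - T v‖ + R)) := fun v k => by
    set r := y - T (cgIter T y x₀ k)
    have h1 : inner 𝕜 r r = inner 𝕜 r (y - T v) +
        inner 𝕜 (adjoint T r) (v - cgIter T y x₀ k) := by
      rw [adjoint_inner_left, ← inner_add_right, map_sub]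
      congr 1
      simp only [r]
      abel
    have h2 : ‖r‖ ^ 2 = ‖inner 𝕜 r r‖ := by
      rw [inner_self_eq_norm_sq_to_K]; simp
    rw [h2, h1]
    refine (norm_add_le _ _).trans (add_le_add (norm_inner_le_norm _ _) ?_)
    refine (norm_inner_le_norm _ _).trans ?_
    gcongr
    exact hbd v k
  have hlim : ∀ a, Tendsto (fun k => ‖adjoint T (y - T (cgIter T y x₀ k))‖ * a) atTop (𝓝 0) :=
    fun a => by simpa using (tendsto_norm_grad_cgIter hT y x₀).mul_const a
  have hρ : Tendsto (fun k => ‖y - T (cgIter T y x₀ k)‖) atTop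
      (𝓝 (⨅ k, ‖y - T (cgIter T y x₀ k)‖)) :=
    tendsto_atTop_ciInf (antitone_norm_res_cgIter hT y x₀)
      ⟨0, by rintro _ ⟨k, rfl⟩; exact norm_nonneg _⟩
  set ρ := ⨅ k, ‖y - T (cgIter T y x₀ k)‖
  have hρ0 : 0 ≤ ρ := ge_of_tendsto' hρ fun _ => norm_nonneg _
  have hρt : t ≤ ρ ^ 2 := ge_of_tendsto' (hρ.pow 2) fun k => (hcon k).le
  have hρv : ∀ v, ρ ≤ ‖y - T v‖ := fun v => by
    have h1 := le_of_tendsto_of_tendsto' (hρ.pow 2)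
      ((hρ.mul_const ‖y - T v‖).add (hlim (|C| * (‖y - T v‖ + R)))) (hkey v)
    rcases hρ0.eq_or_lt with h0 | h0
    · rw [← h0]; exact norm_nonneg _
    · nlinarith
  -- Using `v = u` for one factor and `v = 0` for the other yields `ρ² ≤ e ‖y‖ < t`.
  have h1 := (hρv u).trans hu
  have h2 : ρ ≤ ‖y‖ := by simpa using hρv 0
  have h3 : ρ * ρ ≤ e * ‖y‖ := mul_le_mul h1 h2 hρ0 he
  nlinarith

end CGNE

/-! ### Tolerances and attainability of the discrepancy principle -/

section Levels

variable {𝕜 X Y : Type*} [RCLike 𝕜]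
  [NormedAddCommGroup X] [InnerProductSpace 𝕜 X]
  [NormedAddCommGroup Y] [InnerProductSpace 𝕜 Y]

lemma ContinuouslyInvertible.exists_bound {U : Type*} [NormedAddCommGroup U]
    [InnerProductSpace 𝕜 U] {T : U →L[𝕜] Y} (h : ContinuouslyInvertible T) :
    ∃ C : ℝ, 0 ≤ C ∧ ∀ x, ‖x‖ ≤ C * ‖T x‖ := by
  obtain ⟨A, hA⟩ := h
  refine ⟨‖A‖, norm_nonneg _, fun x => ?_⟩
  have := A.le_opNorm ⟨T x, LinearMap.mem_range_self (T : U →ₗ[𝕜] Y) x⟩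
  rwa [hA x] at this

variable {S : LevelSystem 𝕜 X Y} {η τ δ : ℝ} {xs : X} {yd : Y} {x00 : S.space 0}
  {J M N : ℕ}

lemma sqRes_inclusion (hMN : M ≤ N) (x : S.space M) :
    sqRes S yd N (Submodule.inclusion (S.mono hMN) x) = sqRes S yd M x := by
  simp only [sqRes, S.op_eq hMN]

variable [CompleteSpace X]

lemma norm_starProjection_sub_le_of_le (hMN : M ≤ N) (xs : X) :
    ‖(S.space N).starProjection xs - xs‖ ≤ ‖(S.space M).starProjection xs - xs‖ := by
  rw [norm_sub_rev, norm_sub_rev _ xs, Submodule.starProjection_minimal]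
  exact ciInf_le ⟨0, by rintro _ ⟨k, rfl⟩; exact norm_nonneg _⟩
    (Submodule.inclusion (S.mono hMN) ((S.space M).orthogonalProjectionOnto xs))

lemma levelTol_le_of_le (hη : 0 < η) (hMN : M ≤ N) :
    levelTol S η xs δ yd N ≤ levelTol S η xs δ yd M := by
  unfold levelTol
  gcongr
  exact norm_starProjection_sub_le_of_le hMN xs

lemma levelTol_eq_of_mem (hx : xs ∈ S.space N) :
    levelTol S η xs δ yd N = 2 * (1 + η) * δ * ‖yd‖ := by
  simp [levelTol, Submodule.starProjection_eq_self_iff.mpr hx]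

lemma levelTol_le_finalTol (hη : 0 < η) (hτ : 1 < τ) (hδ : 0 < δ) (hx : xs ∈ S.space N) :
    levelTol S η xs δ yd N ≤ finalTol η τ δ yd := by
  rw [levelTol_eq_of_mem hx, finalTol, mul_right_comm _ τ δ]
  have : 0 ≤ 2 * (1 + η) * δ := by positivity
  nlinarith [mul_le_mul_of_nonneg_right (le_mul_of_one_le_right this hτ.le) (norm_nonneg yd)]

/-- The discrepancy of the projection of the exact solution. -/
lemma norm_sub_op_orthogonalProjectionOnto_le {Nstar : ℕ} {xs : S.space Nstar} {y : Y}
    (hxs : S.op Nstar xs = y) (hy : ‖yd - y‖ ≤ δ) (hN : N ≤ Nstar) :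
    ‖yd - S.op N ((S.space N).orthogonalProjectionOnto (xs : X))‖ ≤
      δ + ‖(S.space N).starProjection (xs : X) - xs‖ := by
  set p := Submodule.inclusion (S.mono hN) ((S.space N).orthogonalProjectionOnto (xs : X)) with hp
  have h1 : yd - S.op N ((S.space N).orthogonalProjectionOnto (xs : X)) =
      (yd - y) - S.op Nstar (p - xs) := by
    rw [map_sub, hp, S.op_eq hN, hxs]; abel
  have h2 := (S.op Nstar).le_of_opNorm_le (S.norm_op_le Nstar) (p - xs)
  rw [one_mul] at h2
  rw [h1]
  exact (norm_sub_le _ _).trans (add_le_add hy h2)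

lemma exists_isStartLevel (hη : 0 < η) (hτ : 1 < τ) (hδ : 0 < δ) (hx : xs ∈ S.space N) :
    ∃ J ≤ N, IsStartLevel S η τ xs δ yd x00 J := by
  by_cases hc : finalTol η τ δ yd < sqRes S yd 0 x00 ∧
      sqRes S yd 0 x00 ≤ levelTol S η xs δ yd 0
  · refine ⟨N, le_rfl, ?_⟩
    rw [IsStartLevel, if_pos hc]
    exact (levelTol_le_finalTol hη hτ hδ hx).trans_lt hc.1
  · exact ⟨0, Nat.zero_le _, by rw [IsStartLevel, if_neg hc]⟩

variable [CompleteSpace Y]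

/-- The discrepancy principle of each level up to `N_*` is reached by CGNE. -/
lemma exists_sqRes_cgIter_le_levelTol {Nstar : ℕ} {xs : S.space Nstar} {y : Y}
    (hη : 0 < η) (hxs : S.op Nstar xs = y) (hinv : ContinuouslyInvertible (S.op Nstar))
    (hδ : 0 < δ) (hyd : yd ≠ 0) (hy : ‖yd - y‖ ≤ δ) (hN : N ≤ Nstar) (z : S.space N) :
    ∃ k, sqRes S yd N (cgIter (S.op N) yd z k) ≤ levelTol S η (xs : X) δ yd N := by
  obtain ⟨C, -, hC⟩ := hinv.exists_bound
  refine exists_norm_sq_cgIter_le (S.norm_op_le N) (C := C) (fun x => ?_) yd z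
    (norm_sub_op_orthogonalProjectionOnto_le hxs hy hN) ?_
  · have := hC (Submodule.inclusion (S.mono hN) x)
    rwa [S.op_eq hN] at this
  · rw [levelTol]
    -- Positivity makes the factor `2 * (1 + η) > 1` a strict gain.
    have h1 : 0 < (δ + ‖(S.space N).starProjection (xs : X) - xs‖) * ‖yd‖ := by
      have := norm_pos_iff.mpr hyd
      positivity
    nlinarith

lemma IsLevelStop.unique {z : S.space N} {k l : ℕ} (hk : IsLevelStop S η xs δ yd N z k)
    (hl : IsLevelStop S η xs δ yd N z l) : k = l := by
  rcases lt_trichotomy k l with h | h | h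
  · exact absurd (hl.1 (k + 1) h) hk.2.not_gt
  · exact h
  · exact absurd (hk.1 (l + 1) h) hl.2.not_gt

/-! ### Determinism, termination and error of the multi-level run -/

namespace Entered

lemma start_le {z : S.space N} (h : Entered S η τ xs δ yd x00 J N z) : J ≤ N := by
  induction h with
  | start => exact le_rfl
  | next _ _ _ ih => exact ih.trans (Nat.le_succ _)

lemma exists_pred {z : S.space (N + 1)} (h : Entered S η τ xs δ yd x00 J (N + 1) z)
    (hJ : J ≠ N + 1) : ∃ (w : S.space N) (k : ℕ), Entered S η τ xs δ yd x00 J N w ∧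
      IsLevelStop S η xs δ yd N w k ∧
      (∀ j ≤ k + 1, finalTol η τ δ yd < sqRes S yd N (cgIter (S.op N) yd w j)) ∧
      z = Submodule.inclusion (S.mono (Nat.le_succ N)) (cgIter (S.op N) yd w k) := by
  cases h with
  | start => exact absurd rfl hJ
  | next hz hk hf => exact ⟨_, _, hz, hk, hf, rfl⟩

lemma unique {z z' : S.space N} (h : Entered S η τ xs δ yd x00 J N z)
    (h' : Entered S η τ xs δ yd x00 J N z') : z = z' := by
  induction h with
  | start =>
    cases h' with
    | start => rfl
    | next hz _ _ => exact absurd hz.start_le (Nat.not_succ_le_self _)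
  | next hz hk hf ih =>
    obtain ⟨w, l, hw, hl, -, rfl⟩ := h'.exists_pred (by have := hz.start_le; omega)
    obtain rfl := ih hw
    rw [hk.unique hl]

lemma exists_isLevelStop_of_lt {z : S.space N} (h : Entered S η τ xs δ yd x00 J N z) (hJM : J ≤ M)
    (hMN : M < N) : ∃ (w : S.space M) (k : ℕ), Entered S η τ xs δ yd x00 J M w ∧
      IsLevelStop S η xs δ yd M w k ∧
      ∀ j ≤ k + 1, finalTol η τ δ yd < sqRes S yd M (cgIter (S.op M) yd w j) := by
  induction h with
  | start => omega
  | next hz hk hf ih =>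
    rcases (Nat.lt_succ_iff.mp hMN).eq_or_lt with rfl | h
    · exact ⟨_, _, hz, hk, hf⟩
    · exact ih h

/-- The algorithm never leaves a level that contains the exact solution. -/
lemma le_of_mem (hη : 0 < η) (hτ : 1 < τ) (hδ : 0 < δ) (hx : xs ∈ S.space M) (hJ : J ≤ M)
    {z : S.space N} (h : Entered S η τ xs δ yd x00 J N z) : N ≤ M := by
  by_contra! hMN
  obtain ⟨w, k, -, hk, hf⟩ := h.exists_isLevelStop_of_lt hJ hMN
  exact (hf (k + 1) le_rfl).not_ge (hk.2.trans (levelTol_le_finalTol hη hτ hδ hx))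

/-- The initial guess of each level either meets the terminal criterion or violates the
discrepancy principle of the level. -/
lemma finalTol_or_levelTol (hη : 0 < η) (hJ : IsStartLevel S η τ xs δ yd x00 J)
    {z : S.space N} (h : Entered S η τ xs δ yd x00 J N z) :
    sqRes S yd N z ≤ finalTol η τ δ yd ∨ levelTol S η xs δ yd N < sqRes S yd N z := by
  induction h with
  | start =>
    rw [sqRes_inclusion (Nat.zero_le J)]
    unfold IsStartLevel at hJ
    split_ifs at hJ with hc
    · exact Or.inr hJ
    · subst hJ
      by_contra! hcon
      exact hc hcon
  | next hz hk hf ih =>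
    rw [sqRes_inclusion (Nat.le_succ _)]
    exact Or.inr ((levelTol_le_of_le hη (Nat.le_succ _)).trans_lt (hk.1 _ le_rfl))

end Entered

/-- Had level `N` been left with index `k`, then `K ≤ k + 1` contradicts the failure of the terminal
criterion there, and `K > k + 1` contradicts the discrepancy principle at `k + 1`. -/
lemma IsOutput.not_entered_of_lt {K : ℕ} {x : X} (h : IsOutput S η τ xs δ yd x00 J N K x)
    (hNM : N < M) {z : S.space M} : ¬ Entered S η τ xs δ yd x00 J M z := fun hM => by
  obtain ⟨z', hz', hK, hterm, -⟩ := h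
  obtain ⟨w, k, hw, hk, hf⟩ := hM.exists_isLevelStop_of_lt hz'.start_le hNM
  obtain rfl := hz'.unique hw
  rcases le_or_gt K (k + 1) with hle | hlt
  · exact (hf K hle).not_ge hterm
  · exact (hK (k + 1) hlt).1.not_ge hk.2

lemma IsOutput.unique {N' K K' : ℕ} {x x' : X} (h : IsOutput S η τ xs δ yd x00 J N K x)
    (h' : IsOutput S η τ xs δ yd x00 J N' K' x') : N = N' ∧ K = K' ∧ x = x' := by
  have hN : N = N' := by
    obtain ⟨z, hz, -⟩ := id h
    obtain ⟨z', hz', -⟩ := id h'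
    by_contra hne
    rcases Nat.lt_or_gt_of_ne hne with hlt | hlt
    · exact h.not_entered_of_lt hlt hz'
    · exact h'.not_entered_of_lt hlt hz
  subst hN
  obtain ⟨z, hz, hK, ht, rfl⟩ := h
  obtain ⟨z', hz', hK', ht', rfl⟩ := h'
  obtain rfl := hz.unique hz'
  have hKK : K = K' := by
    by_contra hne
    rcases Nat.lt_or_gt_of_ne hne with hlt | hlt
    · exact (hK' K hlt).2.not_ge ht
    · exact (hK K' hlt).2.not_ge ht'
  subst hKK
  exact ⟨rfl, rfl, rfl⟩

open Classical in
/-- If CGNE reaches the discrepancy principle on a level, then the level is either left for the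
next one or yields the output. -/
lemma Entered.output_or_next (hη : 0 < η) (hJ : IsStartLevel S η τ xs δ yd x00 J)
    {z : S.space N} (hz : Entered S η τ xs δ yd x00 J N z)
    (hlev : ∃ k, sqRes S yd N (cgIter (S.op N) yd z k) ≤ levelTol S η xs δ yd N) :
    (∃ K x, IsOutput S η τ xs δ yd x00 J N K x) ∨
      ∃ z', Entered S η τ xs δ yd x00 J (N + 1) z' := by
  have hm := Nat.find_spec hlev
  have hlt : ∀ j < Nat.find hlev, levelTol S η xs δ yd N <
      sqRes S yd N (cgIter (S.op N) yd z j) := fun j hj => not_le.mp (Nat.find_min hlev hj)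
  set m := Nat.find hlev
  by_cases hfin : ∃ j ≤ m, sqRes S yd N (cgIter (S.op N) yd z j) ≤ finalTol η τ δ yd
  · left
    have hK := Nat.find_spec hfin
    exact ⟨Nat.find hfin, _, z, hz, fun j hj => ⟨hlt j (hj.trans_le hK.1), by
      have := Nat.find_min hfin hj
      push Not at this
      exact this (hj.le.trans hK.1)⟩, hK.2, rfl⟩
  · right
    push Not at hfin
    -- `k_*` is `m - 1`, so the initial guess itself must not satisfy the discrepancy principle.
    have h0 : m ≠ 0 := fun h0 => by
      rw [h0] at hm
      rcases hz.finalTol_or_levelTol hη hJ with h | h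
      · exact (hfin 0 (Nat.zero_le _)).not_ge h
      · exact h.not_ge hm
    obtain ⟨k, hk⟩ := Nat.exists_eq_succ_of_ne_zero h0
    rw [Nat.succ_eq_add_one] at hk
    exact ⟨_, hz.next (k := k) ⟨fun j hj => hlt j (by omega), hk ▸ hm⟩
      fun j hj => hfin j (by omega)⟩

/-- The multi-level algorithm terminates. -/
lemma exists_isOutput {Nstar : ℕ} {xs : S.space Nstar} {y : Y}
    (hη : 0 < η) (hτ : 1 < τ) (hxs : S.op Nstar xs = y)
    (hinv : ContinuouslyInvertible (S.op Nstar))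
    (hδ : 0 < δ) (hyd : yd ≠ 0) (hy : ‖yd - y‖ ≤ δ) (hJN : J ≤ Nstar)
    (hJ : IsStartLevel S η τ (xs : X) δ yd x00 J) :
    ∃ N K x, IsOutput S η τ (xs : X) δ yd x00 J N K x := by
  by_contra! hno
  -- Without output the run would reach level `N_* + 1`, which `le_of_mem` forbids.
  have hall : ∀ i, J + i ≤ Nstar + 1 → ∃ z, Entered S η τ (xs : X) δ yd x00 J (J + i) z := by
    intro i
    induction i with
    | zero => exact fun _ => ⟨_, Entered.start⟩
    | succ i ih =>
      intro hi
      obtain ⟨z, hz⟩ := ih (by omega)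
      rcases hz.output_or_next hη hJ (exists_sqRes_cgIter_le_levelTol hη hxs hinv hδ hyd hy
        (by omega) z) with ⟨K, x, h⟩ | h
      · exact absurd h (hno _ K x)
      · exact h
  obtain ⟨z, hz⟩ := hall (Nstar + 1 - J) (by omega)
  have := hz.le_of_mem hη hτ hδ xs.2 hJN
  omega

/-- The error of the output of the multi-level algorithm. -/
lemma IsOutput.norm_sub_le {Nstar K : ℕ} {xs : S.space Nstar} {y : Y} {x : X}
    (hη : 0 < η) (hτ : 1 < τ) (hxs : S.op Nstar xs = y) {C : ℝ} (hC0 : 0 ≤ C)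
    (hC : ∀ u, ‖u‖ ≤ C * ‖S.op Nstar u‖)
    (hδ : 0 < δ) (hy : ‖yd - y‖ ≤ δ) (hJN : J ≤ Nstar)
    (h : IsOutput S η τ (xs : X) δ yd x00 J N K x) :
    ‖x - xs‖ ≤ C * (√(2 * (1 + η) * τ * δ * (‖y‖ + δ)) + δ) := by
  obtain ⟨z, hz, -, ht, rfl⟩ := h
  have hN : N ≤ Nstar := hz.le_of_mem hη hτ hδ xs.2 hJN
  set x := cgIter (S.op N) yd z K
  refine (hC (Submodule.inclusion (S.mono hN) x - xs)).trans ?_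
  gcongr
  have h1 : S.op Nstar (Submodule.inclusion (S.mono hN) x - xs) = (S.op N x - yd) + (yd - y) := by
    rw [map_sub, S.op_eq hN, hxs]; abel
  rw [h1]
  refine (norm_add_le _ _).trans (add_le_add (Real.le_sqrt_of_sq_le (ht.trans ?_)) hy)
  rw [finalTol]
  gcongr
  -- `‖yd‖ ≤ ‖y‖ + δ` makes the bound uniform in the data.
  linarith [norm_sub_norm_le yd y]

end Levels

end MultiLevelCG

end

theorem theorem2p7 {𝕜 X Y : Type*} [RCLike 𝕜]
    [NormedAddCommGroup X] [InnerProductSpace 𝕜 X] [CompleteSpace X]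
    [NormedAddCommGroup Y] [InnerProductSpace 𝕜 Y] [CompleteSpace Y]
    (S : MultiLevelCG.LevelSystem 𝕜 X Y) (η τ : ℝ) (hη : 0 < η) (hτ : 1 < τ)
    (Nstar : ℕ) (xs : S.space Nstar) (y : Y) (hxs : S.op Nstar xs = y)
    (hinv : MultiLevelCG.ContinuouslyInvertible (S.op Nstar)) :
    -- for `δ > 0` and nonzero data the algorithm can be started, and it terminates with a
    -- uniquely determined level, index and final iterate
    (∀ δ : ℝ, 0 < δ → ∀ yd : Y, yd ≠ 0 → ‖yd - y‖ ≤ δ → ∀ x00 : S.space 0,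
      (∃ J ≤ Nstar, MultiLevelCG.IsStartLevel S η τ (xs : X) δ yd x00 J) ∧
      ∀ J ≤ Nstar, MultiLevelCG.IsStartLevel S η τ (xs : X) δ yd x00 J →
        ∃! p : ℕ × ℕ × X,
          MultiLevelCG.IsOutput S η τ (xs : X) δ yd x00 J p.1 p.2.1 p.2.2) ∧
    -- the final iterate converges to `x_*` as `δ → 0`
    (∀ ε : ℝ, 0 < ε → ∃ δ₀ : ℝ, 0 < δ₀ ∧ ∀ δ : ℝ, 0 < δ → δ < δ₀ →
      ∀ yd : Y, ‖yd - y‖ ≤ δ → ∀ x00 : S.space 0,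
      ∀ J ≤ Nstar, MultiLevelCG.IsStartLevel S η τ (xs : X) δ yd x00 J →
      ∀ (N K : ℕ) (x : X), MultiLevelCG.IsOutput S η τ (xs : X) δ yd x00 J N K x →
        ‖x - (xs : X)‖ < ε) := by
  refine ⟨fun δ hδ yd hyd hy x00 => ⟨MultiLevelCG.exists_isStartLevel hη hτ hδ xs.2,
    fun J hJN hJ => ?_⟩, fun ε hε => ?_⟩
  · obtain ⟨N, K, x, h⟩ :=
      MultiLevelCG.exists_isOutput hη hτ hxs hinv hδ hyd hy hJN hJ
    refine ⟨(N, K, x), h, ?_⟩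
    rintro ⟨N', K', x'⟩ h'
    obtain ⟨rfl, rfl, rfl⟩ := MultiLevelCG.IsOutput.unique h' h
    rfl
  · obtain ⟨C, hC0, hC⟩ := hinv.exists_bound
    have hcont : Continuous fun δ : ℝ =>
        C * (√(2 * (1 + η) * τ * δ * (‖y‖ + δ)) + δ) := by fun_prop
    have hlim := hcont.tendsto 0
    simp only [mul_zero, zero_mul, Real.sqrt_zero, add_zero] at hlim
    obtain ⟨δ₀, hδ₀, hlt⟩ := Metric.eventually_nhds_iff.mp (hlim.eventually (gt_mem_nhds hε))
    refine ⟨δ₀, hδ₀, fun δ hδ hδlt yd hy x00 J hJN _ N K x h => ?_⟩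
    refine (h.norm_sub_le hη hτ hxs hC0 hC hδ hy hJN).trans_lt (hlt ?_)
    rwa [Real.dist_0_eq_abs, abs_of_pos hδ]
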